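/- **Setting.** Let $p,n,d\ge 1$, let $\mathcal Z\subset\mathbb R^d$ be measurable, and let $\{f_\theta:\theta\in\Theta\}$, $\Theta\subset\mathbb R^p$, be probability densities on $\mathcal Z$ (with respect to Lebesgue measure) such that $f_\theta(z)>0$ for $\theta\in\Theta$, $z\in\mathcal Z$, and $\theta\mapsto f_\theta(z)$ is thrice differentiable in a neighbourhood of each point of $\Theta$. Let $r>0$, $\Theta\subset B_p(0,r)=\{\theta:\|\theta\|\le r\}$, and let $\theta^*\in\Theta$ be such that $\Theta$ contains the segment from $\theta^*$ to each of its points (for instance $\Theta$ convex). Let $z_1,\dots,z_n$ be i.i.d. with density $f_{\theta^*}$, put $M_n(\theta)=-n^{-1}\sum_{i=1}^n\log f_\theta(z_i)$, and for $\tau>0$ let $\hat\theta\in\arg\min_{\theta\in\Theta}\{M_n(\theta)+\tfrac{\tau}{2}\|\theta\|^2\}$ (almost surely). Assume that the score $\partial_\theta\log f_{\theta^*}(z_1)$ is square integrable and let $$F^*_p=\mathbb E\big[\partial_\theta\log f_{\theta^*}(z_1)\,\partial_\theta\log f_{\theta^*}(z_1)^\top\big],\qquad \hat F_{n,p}=\frac1n\sum_{i=1}^n\partial_\theta\log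 f_{\theta^*}(z_i)\,\partial_\theta\log f_{\theta^*}(z_i)^\top .$$ For $j=1,\dots,p$ let $U^j_p(\theta,z)=\partial_{\theta_j}\partial_\theta\partial_\theta^\top\log f_\theta(z)\in\mathbb R^{p\times p}$ and, for a fixed $\delta>0$, define in $[0,\infty]$ $$\beta_p^j=\sup_{z\in\mathcal Z}\sup_{\theta\in\Theta}\|U_p^j(\theta,z)\|_{op},\qquad \alpha_p^j=\sup_{z\in\mathcal Z}\ \sup_{\theta\ne\theta'\in\Theta,\ \|\theta-\theta'\|<\delta}\frac{\|U^j_p(\theta,z)-U^j_p(\theta',z)\|_{op}}{\|\theta-\theta'\|}.$$ Let $R\in\mathbb R^p$ be the Taylor residual of $\partial_\theta M_n$ at $\theta^*$, that is, either the exact remainder $R=\partial_\theta M_n(\hat\theta)-\partial_\theta M_n(\theta^*)-\partial_\theta\partial_\theta^\top M_n(\theta^*)(\hat\theta-\theta^*)$, or any vector with $R_j=(\hat\theta-\theta^*)^\top\,\partial_\theta\partial_\theta^\top\partial_{\theta_j}M_n(\check\theta^j)\,(\hat\theta-\theta^*)$ for some $\check\theta^j\in\Theta$ whose coordinates lie between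 those of $\hat\theta$ and $\theta^*$. Put $V_2=(\hat F_{n,p}+\tau I_p)^{-1}R$ and $\|b\|_A^2=b^\top A b$. **Proposition (Taylor residual bound).** There are an absolute constant $C>0$ and, for each $r>0$, a constant $C_r>0$ depending only on $r$, such that in the above setting, for all $p,n\ge1$ and $\tau,\delta>0$, with probability at least $1-2/p$, $$\|R\|^2\le C\Big(r^6\sum_{j=1}^p(\alpha_p^j)^2\vee r^4\sum_{j=1}^p(\beta_p^j)^2\Big),\qquad \|V_2\|_{F_p^*}^2\le C\,\frac{\lambda_{\max}(F_p^*)}{\tau^2}\Big(r^6\sum_{j=1}^p(\alpha_p^j)^2\vee r^4\sum_{j=1}^p(\beta_p^j)^2\Big),$$ $$\|V_2\|_{F_p^*}^2\le C_r\,\frac{\lambda_{\max}(F_p^*)}{\tau^2}\Big(r^6\sum_{j=1}^p(\beta_p^j)^2\vee r^4\sum_{j=1}^p(\alpha_p^j)^2\Big).$$ -/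

import Mathlib

open MeasureTheory ProbabilityTheory Set Filter Topology
open scoped ENNReal Matrix

noncomputable section

/-- `ℝᵖ` with its Euclidean norm. -/
abbrev Vec (p : ℕ) : Type := EuclideanSpace ℝ (Fin p)

/-- The partial derivative `∂_{θ_j} g`. -/
def partialD {p : ℕ} (j : Fin p) (g : Vec p → ℝ) : Vec p → ℝ :=
  fun θ => fderiv ℝ g θ (EuclideanSpace.single j 1)

/-- The gradient `∂_θ g (θ)`. -/
def gradV {p : ℕ} (g : Vec p → ℝ) (θ : Vec p) : Vec p :=
  WithLp.toLp 2 fun k => partialD k g θ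

/-- The Hessian matrix `∂_θ ∂_θᵀ g (θ)`. -/
def hessM {p : ℕ} (g : Vec p → ℝ) (θ : Vec p) : Matrix (Fin p) (Fin p) ℝ :=
  Matrix.of fun k l => partialD k (partialD l g) θ

/-- The operator norm of a matrix for the Euclidean norm. -/
def opNorm {p : ℕ} (A : Matrix (Fin p) (Fin p) ℝ) : ℝ :=
  ‖Matrix.toEuclideanCLM (n := Fin p) (𝕜 := ℝ) A‖

/-- The largest eigenvalue (used for symmetric matrices of positive size). -/
def lambdaMax {p : ℕ} (A : Matrix (Fin p) (Fin p) ℝ) : ℝ := sSup (spectrum ℝ A)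

/-- The quadratic form `bᵀ A b`, that is the squared weighted norm `‖b‖²_A`. -/
def weightedSq {p : ℕ} (A : Matrix (Fin p) (Fin p) ℝ) (b : Vec p) : ℝ :=
  b.ofLp ⬝ᵥ (A *ᵥ b.ofLp)

/-- A family of positive, thrice differentiable probability densities `f θ`, `θ ∈ Θ ⊆ ℝᵖ`,
on a sample space `Z ⊆ ℝᵈ` (with respect to Lebesgue measure). Values of `f θ z` with `z ∉ Z`
play no role. -/
structure DensityFamily (p d : ℕ) where
  /-- parameter space -/
  Θ : Set (Vec p)
  /-- sample space -/
  Z : Set (Vec d)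
  /-- `f θ z` is the density with parameter `θ` at the point `z` -/
  f : Vec p → Vec d → ℝ
  measurableSet_Z : MeasurableSet Z
  measurable_f : ∀ θ ∈ Θ, Measurable (f θ)
  pos : ∀ θ ∈ Θ, ∀ z ∈ Z, 0 < f θ z
  lintegral_eq_one : ∀ θ ∈ Θ, ∫⁻ z in Z, ENNReal.ofReal (f θ z) = 1
  /-- `θ ↦ f θ z` is thrice differentiable near each point of `Θ` -/
  smooth : ∀ z ∈ Z, ∀ θ ∈ Θ, ∀ᶠ θ' in 𝓝 θ, ∀ k < 3,
    DifferentiableAt ℝ (iteratedFDeriv ℝ k fun t => f t z) θ'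

namespace DensityFamily

variable {p d : ℕ} (m : DensityFamily p d)

/-- The law on `ℝᵈ` with density `f θ` on the sample space. -/
def law (θ : Vec p) : Measure (Vec d) :=
  (volume.restrict m.Z).withDensity fun z => ENNReal.ofReal (m.f θ z)

/-- The log-likelihood `θ ↦ log f_θ(z)` of one observation. -/
def logLik (z : Vec d) (θ : Vec p) : ℝ := Real.log (m.f θ z)

/-- The score `∂_θ log f_θ(z)`. -/
def score (θ : Vec p) (z : Vec d) : Vec p := gradV (m.logLik z) θ

/-- The Fisher information matrix `E[∂_θ log f_θ(Z) (∂_θ log f_θ(Z))ᵀ]`, where `Z` has density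
`f_θ`. -/
def fisher (θ : Vec p) : Matrix (Fin p) (Fin p) ℝ :=
  Matrix.of fun k l => ∫ z, m.score θ z k * m.score θ z l ∂(m.law θ)

/-- The empirical Fisher information matrix at `θ` of a sample `z₁, …, zₙ`. -/
def empFisher {n : ℕ} (z : Fin n → Vec d) (θ : Vec p) : Matrix (Fin p) (Fin p) ℝ :=
  Matrix.of fun k l => (n : ℝ)⁻¹ * ∑ i, m.score θ (z i) k * m.score θ (z i) l

/-- The mean negative log-likelihood `Mₙ(θ) = -n⁻¹ ∑ᵢ log f_θ(zᵢ)`. -/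
def negLogLik {n : ℕ} (z : Fin n → Vec d) (θ : Vec p) : ℝ :=
  -((n : ℝ)⁻¹ * ∑ i, m.logLik (z i) θ)

/-- `t` is a minimizer over `Θ` of the penalized loss `Mₙ(θ) + (τ/2) ‖θ‖²`. -/
def IsPenalizedMLE {n : ℕ} (z : Fin n → Vec d) (τ : ℝ) (t : Vec p) : Prop :=
  t ∈ m.Θ ∧ IsMinOn (fun θ => m.negLogLik z θ + τ / 2 * ‖θ‖ ^ 2) m.Θ t

/-- The matrix `U^j(θ, z) = ∂_{θ_j} ∂_θ ∂_θᵀ log f_θ(z)` of third derivatives. -/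
def thirdD (j : Fin p) (θ : Vec p) (z : Vec d) : Matrix (Fin p) (Fin p) ℝ :=
  Matrix.of fun k l => partialD j (fun t => hessM (m.logLik z) t k l) θ

/-- `β^j`, the supremum of `‖U^j(θ, z)‖_op` over `θ ∈ Θ` and `z` in the sample space. -/
def beta (j : Fin p) : ℝ≥0∞ :=
  ⨆ z ∈ m.Z, ⨆ θ ∈ m.Θ, ENNReal.ofReal (opNorm (m.thirdD j θ z))

/-- `α^j`, the local Lipschitz constant (at scale `δ`) of `θ ↦ U^j(θ, z)` in operator norm,
uniformly over `z` in the sample space. -/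
def alpha (δ : ℝ) (j : Fin p) : ℝ≥0∞ :=
  ⨆ z ∈ m.Z, ⨆ θ ∈ m.Θ, ⨆ θ' ∈ m.Θ, ⨆ (_ : ‖θ - θ'‖ < δ) (_ : θ ≠ θ'),
    ENNReal.ofReal (opNorm (m.thirdD j θ z - m.thirdD j θ' z) / ‖θ - θ'‖)

/-- `R` is the residual of the second order Taylor expansion at `θs` of `∂_θ Mₙ(t)`. It is either
the exact remainder `∂_θ Mₙ(t) - ∂_θ Mₙ(θs) - ∂_θ ∂_θᵀ Mₙ(θs) (t - θs)`, or given
by the quadratic forms `R_j = (t - θs)ᵀ ∂_θ ∂_θᵀ ∂_{θ_j} Mₙ(c j) (t - θs)` for some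
`c j ∈ Θ` each of whose coordinates lies between those of `t` and `θs`. (In Lagrange's
form of the exact remainder, this quadratic form carries the factor `1/2`.) -/
def IsTaylorResidual {n : ℕ} (z : Fin n → Vec d) (θs t R : Vec p) : Prop :=
  R = gradV (m.negLogLik z) t - gradV (m.negLogLik z) θs
      - WithLp.toLp 2 (hessM (m.negLogLik z) θs *ᵥ (t - θs).ofLp) ∨
  ∃ c : Fin p → Vec p, (∀ j, c j ∈ m.Θ ∧ ∀ k, c j k ∈ uIcc (t k) (θs k)) ∧
    ∀ j, R j = weightedSq (hessM (partialD j (m.negLogLik z)) (c j)) (t - θs)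

/-- The scaled Taylor residual `V₂ = (F̂ + τ I)⁻¹ R`. -/
def scaledResidual {n : ℕ} (z : Fin n → Vec d) (τ : ℝ) (θs R : Vec p) : Vec p :=
  WithLp.toLp 2 ((m.empFisher z θs + τ • (1 : Matrix (Fin p) (Fin p) ℝ))⁻¹ *ᵥ R.ofLp)

end DensityFamily

end

/-! The estimate is deterministic once every `z i ω` lies in `Z` and the minimizer lies in `Θ`,
which happens almost surely. The coordinate `R j` is a second-order remainder of the `j`-th partial
derivative of `negLogLik`, controlled by third derivatives, which average the `thirdD j` up to sign.
Hence `|R j| ≤ β_j ‖t - θs‖²` (`abs_taylorResidual_apply_le`). Both points lie in the ball of radius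
`r`, so `‖t - θs‖ ≤ 2r`, and summing squares gives `‖R‖² ≤ 16 r⁴ ∑ β_j²`.

For `V₂`, positive semidefiniteness of the empirical Fisher matrix gives `τ ‖V₂‖ ≤ ‖R‖`, and the
quadratic form of the Fisher matrix is at most `lambdaMax` times the squared norm. The `β` entry of
each maximum suffices: `r⁴ β²` appears in the first two bounds, and `16 r⁴ = (16 / r²) r⁶` yields
the third. -/

/-! ### Third-order differential calculus and the Taylor bound -/

section Calculus

variable {E F : Type*} [NormedAddCommGroup E] [NormedSpace ℝ E]
  [NormedAddCommGroup F] [NormedSpace ℝ F]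

/-- `g` is three times Fréchet differentiable at every point near `x`. -/
def ThriceDiffNear (g : E → F) (x : E) : Prop :=
  ∀ᶠ t in 𝓝 x, DifferentiableAt ℝ g t ∧ DifferentiableAt ℝ (fderiv ℝ g) t ∧
    DifferentiableAt ℝ (fderiv ℝ (fderiv ℝ g)) t

/-- Currying is a linear isometry, so it preserves differentiability; this trades iterated
derivatives for nested `fderiv`. -/
theorem differentiableAt_iteratedFDeriv_succ_iff {g : E → F} {x : E} {k : ℕ} :
    DifferentiableAt ℝ (iteratedFDeriv ℝ (k + 1) g) x ↔
      DifferentiableAt ℝ (iteratedFDeriv ℝ k (fderiv ℝ g)) x := by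
  have h : iteratedFDeriv ℝ (k + 1) g =
      (continuousMultilinearCurryRightEquiv' ℝ k E F).symm ∘ iteratedFDeriv ℝ k (fderiv ℝ g) :=
    funext fun _ => iteratedFDeriv_succ_eq_comp_right
  rw [h]
  exact LinearIsometryEquiv.comp_differentiableAt_iff (𝕜 := ℝ) (G := E)
    (E := ContinuousMultilinearMap ℝ (fun _ : Fin k => E) (E →L[ℝ] F))
    (F := ContinuousMultilinearMap ℝ (fun _ : Fin (k + 1) => E) F)
    (continuousMultilinearCurryRightEquiv' ℝ k E F).symm

theorem differentiableAt_iteratedFDeriv_zero_iff {g : E → F} {x : E} :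
    DifferentiableAt ℝ (iteratedFDeriv ℝ 0 g) x ↔ DifferentiableAt ℝ g x := by
  rw [iteratedFDeriv_zero_eq_comp, LinearIsometryEquiv.comp_differentiableAt_iff]

theorem thriceDiffNear_of_iteratedFDeriv {g : E → F} {x : E}
    (h : ∀ᶠ t in 𝓝 x, ∀ k < 3, DifferentiableAt ℝ (iteratedFDeriv ℝ k g) t) :
    ThriceDiffNear g x := by
  filter_upwards [h] with t ht
  refine ⟨differentiableAt_iteratedFDeriv_zero_iff.1 (ht 0 (by norm_num)), ?_, ?_⟩
  · exact differentiableAt_iteratedFDeriv_zero_iff.1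
      (differentiableAt_iteratedFDeriv_succ_iff.1 (ht 1 (by norm_num)))
  · exact differentiableAt_iteratedFDeriv_zero_iff.1
      (differentiableAt_iteratedFDeriv_succ_iff.1
        (differentiableAt_iteratedFDeriv_succ_iff.1 (ht 2 (by norm_num))))

theorem DifferentiableAt.clm_smulRight {c : E → E →L[ℝ] ℝ} {G : E → F} {x : E}
    (hc : DifferentiableAt ℝ c x) (hG : DifferentiableAt ℝ G x) :
    DifferentiableAt ℝ (fun t => (c t).smulRight (G t)) x :=
  DifferentiableAt.comp (f := fun t => (c t, G t))
    (g := fun q : (E →L[ℝ] ℝ) × F => q.1.smulRight q.2) x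
    (isBoundedBilinearMap_smulRight.differentiableAt (c x, G x)) (hc.prodMk hG)

/-- Positivity persists near `x`. There the first two derivatives are `g⁻¹ Dg` and `g⁻¹ D²g - g⁻² Dg
⊗ Dg`, both differentiable. -/
theorem ThriceDiffNear.log {g : E → ℝ} {x : E} (h : ThriceDiffNear g x) (hx : 0 < g x) :
    ThriceDiffNear (fun t => Real.log (g t)) x := by
  have hpos : ∀ᶠ t in 𝓝 x, 0 < g t :=
    h.self_of_nhds.1.continuousAt.eventually (lt_mem_nhds hx)
  have h1 : fderiv ℝ (fun t => Real.log (g t)) =ᶠ[𝓝 x] fun t => (g t)⁻¹ • fderiv ℝ g t := by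
    filter_upwards [h, hpos] with t ht htp
    exact (ht.1.hasFDerivAt.log htp.ne').fderiv
  have h2 : fderiv ℝ (fderiv ℝ (fun t => Real.log (g t))) =ᶠ[𝓝 x] fun t =>
      (g t)⁻¹ • fderiv ℝ (fderiv ℝ g) t +
        (-((g t) ^ 2)⁻¹ • fderiv ℝ g t).smulRight (fderiv ℝ g t) := by
    filter_upwards [h, hpos, h1.eventuallyEq_nhds] with t ht htp h1t
    rw [h1t.fderiv_eq]
    have hinv : HasFDerivAt (fun s => (g s)⁻¹) (-((g t) ^ 2)⁻¹ • fderiv ℝ g t) t :=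
      (hasDerivAt_inv htp.ne').comp_hasFDerivAt t ht.1.hasFDerivAt
    exact (hinv.smul ht.2.1.hasFDerivAt).fderiv
  filter_upwards [h, hpos, h1.eventuallyEq_nhds, h2.eventuallyEq_nhds] with t ht htp h1t h2t
  refine ⟨ht.1.log htp.ne', h1t.differentiableAt_iff.2 ?_, h2t.differentiableAt_iff.2 ?_⟩
  · exact (ht.1.inv htp.ne').smul ht.2.1
  · refine ((ht.1.inv htp.ne').smul ht.2.2).add (DifferentiableAt.clm_smulRight ?_ ht.2.1)
    exact (((ht.1.pow 2).inv (pow_ne_zero 2 htp.ne')).neg).smul ht.2.1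

theorem fderiv_const_smul_sum_eventuallyEq {ι : Type*} [Fintype ι] {G : ι → E → F} {x : E} (c : ℝ)
    (h : ∀ i, ∀ᶠ t in 𝓝 x, DifferentiableAt ℝ (G i) t) :
    fderiv ℝ (fun t => c • ∑ i, G i t) =ᶠ[𝓝 x] fun t => c • ∑ i, fderiv ℝ (G i) t := by
  filter_upwards [eventually_all.2 h] with t ht
  exact ((HasFDerivAt.fun_sum fun i _ => (ht i).hasFDerivAt).const_smul c).fderiv

theorem differentiableAt_const_smul_sum {ι : Type*} [Fintype ι] {G : ι → E → F} {x : E} (c : ℝ)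
    (h : ∀ i, DifferentiableAt ℝ (G i) x) : DifferentiableAt ℝ (fun t => c • ∑ i, G i t) x :=
  (DifferentiableAt.fun_sum fun i _ => h i).const_smul c

theorem DifferentiableAt.hasDerivAt_line {G : E → F} {x h : E} {s : ℝ}
    (hG : DifferentiableAt ℝ G (x + s • h)) :
    HasDerivAt (fun s : ℝ => G (x + s • h)) (fderiv ℝ G (x + s • h) h) s := by
  have hline : HasDerivAt (fun s : ℝ => x + s • h) h s := by
    simpa using ((hasDerivAt_id s).smul_const h).const_add x
  exact hG.hasFDerivAt.comp_hasDerivAt s hline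

theorem HasDerivAt.clm_apply_const {φ : ℝ → E →L[ℝ] F} {φ' : E →L[ℝ] F} {s : ℝ}
    (hφ : HasDerivAt φ φ' s) (e : E) : HasDerivAt (fun s => φ s e) (φ' e) s :=
  ((ContinuousLinearMap.apply ℝ F e).hasFDerivAt).comp_hasDerivAt s hφ

section ConstSmulSum

variable {ι : Type*} [Fintype ι] {G : ι → E → F} {x : E} (c : ℝ)

theorem fderiv_fderiv_const_smul_sum_eventuallyEq (h : ∀ i, ThriceDiffNear (G i) x) :
    fderiv ℝ (fderiv ℝ fun t => c • ∑ i, G i t) =ᶠ[𝓝 x]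
      fun t => c • ∑ i, fderiv ℝ (fderiv ℝ (G i)) t :=
  (fderiv_const_smul_sum_eventuallyEq c fun i => (h i).mono fun _ ht => ht.1).fderiv.trans
    (fderiv_const_smul_sum_eventuallyEq c fun i => (h i).mono fun _ ht => ht.2.1)

theorem fderiv_fderiv_fderiv_const_smul_sum (h : ∀ i, ThriceDiffNear (G i) x) :
    fderiv ℝ (fderiv ℝ (fderiv ℝ fun t => c • ∑ i, G i t)) x =
      c • ∑ i, fderiv ℝ (fderiv ℝ (fderiv ℝ (G i))) x := by
  rw [(fderiv_fderiv_const_smul_sum_eventuallyEq c h).fderiv_eq]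
  exact (fderiv_const_smul_sum_eventuallyEq (G := fun i => fderiv ℝ (fderiv ℝ (G i))) c
    fun i => (h i).mono fun _ ht => ht.2.2).self_of_nhds

theorem ThriceDiffNear.const_smul_sum (h : ∀ i, ThriceDiffNear (G i) x) :
    ThriceDiffNear (fun t => c • ∑ i, G i t) x := by
  filter_upwards [eventually_all.2 h,
    (fderiv_const_smul_sum_eventuallyEq c fun i =>
      (h i).mono fun _ ht => ht.1).eventuallyEq_nhds,
    (fderiv_fderiv_const_smul_sum_eventuallyEq c h).eventuallyEq_nhds] with t ht h1 h2
  exact ⟨differentiableAt_const_smul_sum c fun i => (ht i).1,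
    h1.differentiableAt_iff.2 (differentiableAt_const_smul_sum c fun i => (ht i).2.1),
    h2.differentiableAt_iff.2 (differentiableAt_const_smul_sum
      (G := fun i => fderiv ℝ (fderiv ℝ (G i))) c fun i => (ht i).2.2)⟩

end ConstSmulSum

theorem ThriceDiffNear.fderiv_fderiv_comm {g : E → F} {x : E} (h : ThriceDiffNear g x) (u v : E) :
    fderiv ℝ (fderiv ℝ g) x u v = fderiv ℝ (fderiv ℝ g) x v u :=
  second_derivative_symmetric_of_eventually (h.mono fun _ ht => ht.1.hasFDerivAt)
    h.self_of_nhds.2.1.hasFDerivAt u v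

theorem ThriceDiffNear.eventually_thriceDiffNear {g : E → F} {x : E} (h : ThriceDiffNear g x) :
    ∀ᶠ t in 𝓝 x, ThriceDiffNear g t :=
  h.eventually_nhds

/-- Symmetry of the second derivative of the map `fderiv ℝ g`. -/
theorem ThriceDiffNear.third_comm_left {g : E → F} {x : E} (h : ThriceDiffNear g x) (u v w : E) :
    fderiv ℝ (fderiv ℝ (fderiv ℝ g)) x u v w = fderiv ℝ (fderiv ℝ (fderiv ℝ g)) x v u w :=
  DFunLike.congr_fun (second_derivative_symmetric_of_eventually
    (h.mono fun _ ht => ht.2.1.hasFDerivAt) h.self_of_nhds.2.2.hasFDerivAt u v) w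

theorem ThriceDiffNear.fderiv_second_apply {g : E → F} {x : E} (h : ThriceDiffNear g x)
    (u v w : E) :
    fderiv ℝ (fun t => fderiv ℝ (fderiv ℝ g) t v w) x u =
      fderiv ℝ (fderiv ℝ (fderiv ℝ g)) x u v w := by
  have h1 := h.self_of_nhds.2.2.hasFDerivAt
  have h2 := (h1.clm_apply (hasFDerivAt_const v x)).clm_apply (hasFDerivAt_const w x)
  rw [h2.fderiv]
  simp

/-- Symmetry of the second derivative holds on a whole neighbourhood, so it can be differentiated.
-/
theorem ThriceDiffNear.third_comm_right {g : E → F} {x : E} (h : ThriceDiffNear g x) (u v w : E) :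
    fderiv ℝ (fderiv ℝ (fderiv ℝ g)) x u v w = fderiv ℝ (fderiv ℝ (fderiv ℝ g)) x u w v := by
  rw [← h.fderiv_second_apply, ← h.fderiv_second_apply]
  have : (fun t => fderiv ℝ (fderiv ℝ g) t v w) =ᶠ[𝓝 x]
      fun t => fderiv ℝ (fderiv ℝ g) t w v :=
    h.eventually_thriceDiffNear.mono fun t ht => ht.fderiv_fderiv_comm v w
  rw [this.fderiv_eq]

/-- Second order Taylor bound for the derivative of `g` along the segment from `x` to `x + h`,
tested against the direction `e`. -/
theorem abs_fderiv_sub_sub_le {g : E → ℝ} {x h e : E} {B : ℝ}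
    (hg : ∀ s ∈ Icc (0 : ℝ) 1, ThriceDiffNear g (x + s • h))
    (hB : ∀ s ∈ Icc (0 : ℝ) 1, |fderiv ℝ (fderiv ℝ (fderiv ℝ g)) (x + s • h) h h e| ≤ B) :
    |fderiv ℝ g (x + h) e - fderiv ℝ g x e - fderiv ℝ (fderiv ℝ g) x h e| ≤ B := by
  have hφ : ∀ s ∈ Icc (0 : ℝ) 1, HasDerivAt (fun s : ℝ => fderiv ℝ g (x + s • h) e)
      (fderiv ℝ (fderiv ℝ g) (x + s • h) h e) s := fun s hs => by
    have h1 : HasDerivAt (fun s : ℝ => fderiv ℝ g (x + s • h))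
        (fderiv ℝ (fderiv ℝ g) (x + s • h) h) s :=
      (hg s hs).self_of_nhds.2.1.hasDerivAt_line
    exact h1.clm_apply_const e
  have hφ' : ∀ s ∈ Icc (0 : ℝ) 1,
      HasDerivAt (fun s : ℝ => fderiv ℝ (fderiv ℝ g) (x + s • h) h e)
      (fderiv ℝ (fderiv ℝ (fderiv ℝ g)) (x + s • h) h h e) s := fun s hs => by
    have h1 : HasDerivAt (fun s : ℝ => fderiv ℝ (fderiv ℝ g) (x + s • h))
        (fderiv ℝ (fderiv ℝ (fderiv ℝ g)) (x + s • h) h) s :=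
      DifferentiableAt.hasDerivAt_line (G := fderiv ℝ (fderiv ℝ g)) (hg s hs).self_of_nhds.2.2
    have h2 : HasDerivAt (fun s : ℝ => fderiv ℝ (fderiv ℝ g) (x + s • h) h)
        (fderiv ℝ (fderiv ℝ (fderiv ℝ g)) (x + s • h) h h) s :=
      HasDerivAt.clm_apply_const (F := E →L[ℝ] ℝ) h1 h
    exact h2.clm_apply_const e
  have hB0 : 0 ≤ B := (abs_nonneg _).trans (hB 0 (by simp))
  have hbound : ∀ s ∈ Icc (0 : ℝ) 1,
      |fderiv ℝ (fderiv ℝ g) (x + s • h) h e - fderiv ℝ (fderiv ℝ g) x h e| ≤ B := fun s hs => by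
    have := norm_image_sub_le_of_norm_deriv_le_segment'
      (fun s hs => (hφ' s hs).hasDerivWithinAt) (fun s hs => hB s (Ico_subset_Icc_self hs)) s hs
    rw [zero_smul, add_zero, sub_zero, Real.norm_eq_abs] at this
    exact this.trans (mul_le_of_le_one_right hB0 hs.2)
  -- With the linear term subtracted, the derivative in `s` is the increment bounded in `hbound`.
  -- Bounding by `B` instead of `s * B` gives up Lagrange's factor `1/2`, but needs no continuity of
  -- the third derivative.
  have := norm_image_sub_le_of_norm_deriv_le_segment_01'
    (f := fun s : ℝ => fderiv ℝ g (x + s • h) e - s * fderiv ℝ (fderiv ℝ g) x h e)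
    (fun s hs => ((hφ s hs).sub ((hasDerivAt_id s).mul_const _)).hasDerivWithinAt)
    (fun s hs => by simpa using hbound s (Ico_subset_Icc_self hs))
  simpa [sub_right_comm] using this

end Calculus

/-! ### Partial derivatives as Fréchet derivatives on basis vectors -/

section Partial

variable {p : ℕ}

theorem gradV_apply (g : Vec p → ℝ) (θ : Vec p) (j : Fin p) :
    gradV g θ j = fderiv ℝ g θ (EuclideanSpace.single j 1) := rfl

theorem partialD_partialD_eq {g : Vec p → ℝ} {θ : Vec p}
    (h : DifferentiableAt ℝ (fderiv ℝ g) θ) (k l : Fin p) :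
    partialD k (partialD l g) θ =
      fderiv ℝ (fderiv ℝ g) θ (EuclideanSpace.single k 1) (EuclideanSpace.single l 1) := by
  have := (h.hasFDerivAt.clm_apply (hasFDerivAt_const (EuclideanSpace.single l (1 : ℝ)) θ)).fderiv
  change fderiv ℝ (fun t => fderiv ℝ g t (EuclideanSpace.single l 1)) θ _ = _
  rw [this]
  simp

theorem partialD_partialD_partialD_eq {g : Vec p → ℝ} {θ : Vec p}
    (h : ThriceDiffNear g θ) (j k l : Fin p) :
    partialD j (partialD k (partialD l g)) θ =
      fderiv ℝ (fderiv ℝ (fderiv ℝ g)) θ (EuclideanSpace.single j 1)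
        (EuclideanSpace.single k 1) (EuclideanSpace.single l 1) := by
  rw [← h.fderiv_second_apply]
  have : partialD k (partialD l g) =ᶠ[𝓝 θ] fun t =>
      fderiv ℝ (fderiv ℝ g) t (EuclideanSpace.single k 1) (EuclideanSpace.single l 1) :=
    h.mono fun t ht => partialD_partialD_eq ht.2.1 k l
  exact DFunLike.congr_fun this.fderiv_eq _

theorem sum_coord_mul_single (φ : Vec p →L[ℝ] ℝ) (b : Vec p) :
    ∑ l, φ (EuclideanSpace.single l 1) * b l = φ b := by
  have hb : b = ∑ l, b l • EuclideanSpace.single l (1 : ℝ) := by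
    simpa using ((EuclideanSpace.basisFun (Fin p) ℝ).sum_repr b).symm
  conv_rhs => rw [hb]
  simp [map_sum, mul_comm]

theorem weightedSq_of_bilinear (B : Vec p →L[ℝ] Vec p →L[ℝ] ℝ) (b : Vec p) :
    weightedSq (Matrix.of fun k l => B (EuclideanSpace.single k 1) (EuclideanSpace.single l 1)) b
      = B b b := by
  rw [← B.flip_apply b b, ← sum_coord_mul_single (B.flip b) b]
  simp only [weightedSq, dotProduct, Matrix.mulVec, Matrix.of_apply,
    ContinuousLinearMap.flip_apply]
  exact Finset.sum_congr rfl fun k _ => by rw [sum_coord_mul_single, mul_comm]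

/-- Symmetry of the third derivative moves `∂_j` to the last slot, the position it has in the Taylor
bound for the `j`-th gradient coordinate. -/
theorem weightedSq_hessM_partialD {g : Vec p → ℝ} {θ : Vec p} (h : ThriceDiffNear g θ) (j : Fin p)
    (b : Vec p) :
    weightedSq (hessM (partialD j g) θ) b =
      fderiv ℝ (fderiv ℝ (fderiv ℝ g)) θ b b (EuclideanSpace.single j 1) := by
  rw [h.third_comm_right, h.third_comm_left, ← weightedSq_of_bilinear]
  congr 1
  ext k l
  rw [hessM, Matrix.of_apply, Matrix.of_apply, partialD_partialD_partialD_eq h,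
    h.third_comm_right, h.third_comm_left]

theorem hessM_mulVec_apply {g : Vec p → ℝ} {θ : Vec p} (h : ThriceDiffNear g θ) (b : Vec p)
    (j : Fin p) :
    (hessM g θ *ᵥ b.ofLp) j = fderiv ℝ (fderiv ℝ g) θ b (EuclideanSpace.single j 1) := by
  rw [h.fderiv_fderiv_comm, ← sum_coord_mul_single]
  simp only [Matrix.mulVec, dotProduct, hessM, Matrix.of_apply,
    partialD_partialD_eq h.self_of_nhds.2.1]

end Partial

/-! ### Quadratic forms, largest eigenvalue, regularized inverse -/

section MatrixBounds

variable {p : ℕ}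

theorem abs_weightedSq_le_opNorm (A : Matrix (Fin p) (Fin p) ℝ) (b : Vec p) :
    |weightedSq A b| ≤ opNorm A * ‖b‖ ^ 2 := by
  have h : weightedSq A b = inner ℝ b (Matrix.toEuclideanCLM (n := Fin p) (𝕜 := ℝ) A b) := by
    rw [Matrix.inner_toEuclideanCLM]; rfl
  rw [h]
  calc _ ≤ ‖b‖ * ‖Matrix.toEuclideanCLM (n := Fin p) (𝕜 := ℝ) A b‖ := abs_real_inner_le_norm _ _
    _ ≤ ‖b‖ * (opNorm A * ‖b‖) := by gcongr; exact ContinuousLinearMap.le_opNorm _ _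
    _ = _ := by ring

theorem dotProduct_self_eq_norm_sq (b : Vec p) : b.ofLp ⬝ᵥ b.ofLp = ‖b‖ ^ 2 := by
  simp [EuclideanSpace.real_norm_sq_eq, dotProduct, ← sq]

/-- The eigenvalues of `lambdaMax A • 1 - A` are the differences `lambdaMax A - a ≥ 0` with `a` in
the spectrum, so this matrix is positive semidefinite. -/
theorem weightedSq_le_lambdaMax {A : Matrix (Fin p) (Fin p) ℝ} (hA : A.IsHermitian) (b : Vec p) :
    weightedSq A b ≤ lambdaMax A * ‖b‖ ^ 2 := by
  have hbdd : BddAbove (spectrum ℝ A) := by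
    rw [hA.spectrum_real_eq_range_eigenvalues]
    exact (finite_range _).bddAbove
  have hB : (algebraMap ℝ (Matrix (Fin p) (Fin p) ℝ) (lambdaMax A) - A).IsHermitian := by
    rw [Algebra.algebraMap_eq_smul_one]
    refine Matrix.IsHermitian.sub ?_ hA
    simp [Matrix.IsHermitian]
  have hpsd : (algebraMap ℝ (Matrix (Fin p) (Fin p) ℝ) (lambdaMax A) - A).PosSemidef := by
    rw [hB.posSemidef_iff_eigenvalues_nonneg]
    intro i
    have hi : hB.eigenvalues i ∈ spectrum ℝ (algebraMap ℝ _ (lambdaMax A) - A) :=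
      hB.spectrum_real_eq_range_eigenvalues ▸ mem_range_self i
    rw [← spectrum.singleton_sub_eq] at hi
    obtain ⟨a, ha, hai⟩ : ∃ a ∈ spectrum ℝ A, lambdaMax A - a = hB.eigenvalues i := by
      simpa using hi
    have : a ≤ lambdaMax A := le_csSup hbdd ha
    simp only [Pi.zero_apply]
    linarith
  have h := hpsd.dotProduct_mulVec_nonneg b.ofLp
  rw [Algebra.algebraMap_eq_smul_one, Matrix.sub_mulVec, Matrix.smul_mulVec, Matrix.one_mulVec,
    dotProduct_sub, dotProduct_smul, star_trivial, dotProduct_self_eq_norm_sq, smul_eq_mul] at h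
  unfold weightedSq
  linarith

/-- Pairing `(A + τ) v = R` with `v` gives `τ ‖v‖² ≤ v ⬝ᵥ R ≤ ‖v‖ ‖R‖`; then cancel `‖v‖`. -/
theorem norm_inv_add_smul_one_mulVec_le {A : Matrix (Fin p) (Fin p) ℝ} (hA : A.PosSemidef)
    {τ : ℝ} (hτ : 0 < τ) (R : Vec p) :
    τ * ‖(WithLp.toLp 2 ((A + τ • (1 : Matrix (Fin p) (Fin p) ℝ))⁻¹ *ᵥ R.ofLp) : Vec p)‖ ≤ ‖R‖ := by
  have hunit : IsUnit (A + τ • (1 : Matrix (Fin p) (Fin p) ℝ)) :=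
    (Matrix.PosDef.posSemidef_add hA (Matrix.PosDef.one.smul hτ)).isUnit
  set v : Vec p := WithLp.toLp 2 ((A + τ • (1 : Matrix (Fin p) (Fin p) ℝ))⁻¹ *ᵥ R.ofLp) with hv
  have hR : (A + τ • (1 : Matrix (Fin p) (Fin p) ℝ)) *ᵥ v.ofLp = R.ofLp := by
    rw [hv, Matrix.mulVec_mulVec, Matrix.mul_nonsing_inv _ ((Matrix.isUnit_iff_isUnit_det _).1 hunit),
      Matrix.one_mulVec]
  have hinner : v.ofLp ⬝ᵥ R.ofLp ≤ ‖v‖ * ‖R‖ := by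
    have := real_inner_le_norm R v
    rw [EuclideanSpace.inner_eq_star_dotProduct, star_trivial] at this
    linarith [mul_comm ‖R‖ ‖v‖]
  have hquad : τ * ‖v‖ ^ 2 ≤ v.ofLp ⬝ᵥ R.ofLp := by
    have h := hA.dotProduct_mulVec_nonneg v.ofLp
    rw [star_trivial] at h
    rw [← hR, Matrix.add_mulVec, Matrix.smul_mulVec, Matrix.one_mulVec, dotProduct_add,
      dotProduct_smul, dotProduct_self_eq_norm_sq, smul_eq_mul]
    linarith
  rcases (norm_nonneg v).eq_or_lt with h0 | h0
  · rw [← h0, mul_zero]; exact norm_nonneg R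
  · exact le_of_mul_le_mul_left (by nlinarith) h0

end MatrixBounds

/-! ### From the residual to the scaled residual -/

namespace DensityFamily

variable {p d : ℕ} (m : DensityFamily p d)

theorem isHermitian_fisher (θ : Vec p) : (m.fisher θ).IsHermitian := by
  ext k l
  simp [fisher, mul_comm]

theorem posSemidef_empFisher {n : ℕ} (z : Fin n → Vec d) (θ : Vec p) :
    (m.empFisher z θ).PosSemidef := by
  have h : m.empFisher z θ = (n : ℝ)⁻¹ • ∑ i,
      Matrix.vecMulVec (m.score θ (z i)).ofLp (star (m.score θ (z i)).ofLp) := by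
    ext k l
    simp [empFisher, Matrix.sum_apply, Matrix.vecMulVec_apply]
  rw [h]
  exact (Matrix.posSemidef_sum _ fun i _ => Matrix.posSemidef_vecMulVec_self_star _).smul
    (by positivity)

theorem weightedSq_scaledResidual_le {n : ℕ} (z : Fin n → Vec d) {τ : ℝ} (hτ : 0 < τ)
    (θs R : Vec p) :
    ENNReal.ofReal (weightedSq (m.fisher θs) (m.scaledResidual z τ θs R)) ≤
      ENNReal.ofReal (lambdaMax (m.fisher θs) / τ ^ 2) * ENNReal.ofReal (‖R‖ ^ 2) := by
  have h1 := weightedSq_le_lambdaMax (m.isHermitian_fisher θs) (m.scaledResidual z τ θs R)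
  have h2 : τ * ‖m.scaledResidual z τ θs R‖ ≤ ‖R‖ :=
    norm_inv_add_smul_one_mulVec_le (m.posSemidef_empFisher z θs) hτ R
  set w := ‖m.scaledResidual z τ θs R‖
  have hw : lambdaMax (m.fisher θs) * w ^ 2 =
      (τ * w) ^ 2 * (lambdaMax (m.fisher θs) / τ ^ 2) := by
    field_simp
  calc _ ≤ ENNReal.ofReal ((τ * w) ^ 2 * (lambdaMax (m.fisher θs) / τ ^ 2)) :=
        ENNReal.ofReal_le_ofReal (h1.trans_eq hw)
    -- Only the square has to be nonnegative for the product to split, so no sign of `lambdaMax` is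
    -- needed.
    _ = ENNReal.ofReal (lambdaMax (m.fisher θs) / τ ^ 2) * ENNReal.ofReal ((τ * w) ^ 2) := by
        rw [ENNReal.ofReal_mul (by positivity), mul_comm]
    _ ≤ _ := by gcongr

end DensityFamily

/-! ### Bounds on the Taylor residual by third derivatives -/

namespace DensityFamily

variable {p d : ℕ} (m : DensityFamily p d)

theorem thriceDiffNear_logLik {z : Vec d} (hz : z ∈ m.Z) {θ : Vec p} (hθ : θ ∈ m.Θ) :
    ThriceDiffNear (m.logLik z) θ :=
  (thriceDiffNear_of_iteratedFDeriv (m.smooth z hz θ hθ)).log (m.pos θ hθ z hz)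

theorem negLogLik_eq_smul_sum {n : ℕ} (z : Fin n → Vec d) :
    m.negLogLik z = fun θ => (-(n : ℝ)⁻¹) • ∑ i, m.logLik (z i) θ := by
  ext θ
  simp [negLogLik]

theorem thriceDiffNear_negLogLik {n : ℕ} {z : Fin n → Vec d} (hz : ∀ i, z i ∈ m.Z) {θ : Vec p}
    (hθ : θ ∈ m.Θ) : ThriceDiffNear (m.negLogLik z) θ := by
  rw [negLogLik_eq_smul_sum]
  exact ThriceDiffNear.const_smul_sum _ fun i => m.thriceDiffNear_logLik (hz i) hθ

theorem weightedSq_thirdD {z : Vec d} (hz : z ∈ m.Z) {θ : Vec p} (hθ : θ ∈ m.Θ) (j : Fin p)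
    (b : Vec p) :
    weightedSq (m.thirdD j θ z) b =
      fderiv ℝ (fderiv ℝ (fderiv ℝ (m.logLik z))) θ b b (EuclideanSpace.single j 1) := by
  have h := m.thriceDiffNear_logLik hz hθ
  rw [h.third_comm_right, h.third_comm_left, ← weightedSq_of_bilinear]
  congr 1
  ext k l
  exact partialD_partialD_partialD_eq h j k l

theorem ofReal_opNorm_thirdD_le_beta {z : Vec d} (hz : z ∈ m.Z) {θ : Vec p} (hθ : θ ∈ m.Θ)
    (j : Fin p) : ENNReal.ofReal (opNorm (m.thirdD j θ z)) ≤ m.beta j :=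
  (le_iSup₂_of_le (f := fun θ (_ : θ ∈ m.Θ) => ENNReal.ofReal (opNorm (m.thirdD j θ z)))
    θ hθ le_rfl).trans
    (le_iSup₂ (f := fun z (_ : z ∈ m.Z) =>
      ⨆ θ ∈ m.Θ, ENNReal.ofReal (opNorm (m.thirdD j θ z))) z hz)

theorem abs_third_negLogLik_le {n : ℕ} (hn : 1 ≤ n) {z : Fin n → Vec d} (hz : ∀ i, z i ∈ m.Z)
    {θ : Vec p} (hθ : θ ∈ m.Θ) {j : Fin p} (hβ : m.beta j ≠ ∞) (b : Vec p) :
    |fderiv ℝ (fderiv ℝ (fderiv ℝ (m.negLogLik z))) θ b b (EuclideanSpace.single j 1)| ≤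
      (m.beta j).toReal * ‖b‖ ^ 2 := by
  have hn' : (0 : ℝ) < n := by exact_mod_cast hn
  have hone : ∀ i, |weightedSq (m.thirdD j θ (z i)) b| ≤ (m.beta j).toReal * ‖b‖ ^ 2 := fun i => by
    refine (abs_weightedSq_le_opNorm _ b).trans ?_
    gcongr
    exact (ENNReal.ofReal_le_iff_le_toReal hβ).1 (m.ofReal_opNorm_thirdD_le_beta (hz i) hθ j)
  have hsum : fderiv ℝ (fderiv ℝ (fderiv ℝ (m.negLogLik z))) θ b b (EuclideanSpace.single j 1) =
      -(n : ℝ)⁻¹ * ∑ i, weightedSq (m.thirdD j θ (z i)) b := by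
    rw [negLogLik_eq_smul_sum,
      fderiv_fderiv_fderiv_const_smul_sum _ fun i => m.thriceDiffNear_logLik (hz i) hθ]
    simp only [m.weightedSq_thirdD (hz _) hθ]
    simp
  rw [hsum, abs_mul, abs_neg, abs_of_pos (inv_pos.2 hn'), inv_mul_le_iff₀ hn']
  refine (Finset.abs_sum_le_sum_abs _ _).trans ((Finset.sum_le_sum fun i _ => hone i).trans_eq ?_)
  simp

theorem abs_taylorResidual_apply_le {n : ℕ} (hn : 1 ≤ n) {z : Fin n → Vec d}
    (hz : ∀ i, z i ∈ m.Z) {θs t R : Vec p} (hθs : θs ∈ m.Θ) (hstar : StarConvex ℝ θs m.Θ)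
    (ht : t ∈ m.Θ) (hR : m.IsTaylorResidual z θs t R) {j : Fin p} (hβ : m.beta j ≠ ∞) :
    |R j| ≤ (m.beta j).toReal * ‖t - θs‖ ^ 2 := by
  rcases hR with rfl | ⟨c, hc, hR⟩
  -- The exact remainder needs the whole segment inside `Θ`, where smoothness and `beta` are
  -- available; the quadratic-form residual only needs the points `c j`.
  · have hseg : ∀ s ∈ Icc (0 : ℝ) 1, θs + s • (t - θs) ∈ m.Θ := fun s hs =>
      hstar.add_smul_sub_mem ht hs.1 hs.2
    have h := abs_fderiv_sub_sub_le (g := m.negLogLik z) (x := θs) (h := t - θs)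
      (e := EuclideanSpace.single j 1)
      (fun s hs => m.thriceDiffNear_negLogLik hz (hseg s hs))
      (fun s hs => m.abs_third_negLogLik_le hn hz (hseg s hs) hβ (t - θs))
    rw [add_sub_cancel, ← hessM_mulVec_apply (m.thriceDiffNear_negLogLik hz hθs)] at h
    exact h
  · rw [hR, weightedSq_hessM_partialD (m.thriceDiffNear_negLogLik hz (hc j).1)]
    exact m.abs_third_negLogLik_le hn hz (hc j).1 hβ _

theorem norm_sq_taylorResidual_le {n : ℕ} (hn : 1 ≤ n) {r : ℝ} (hr : 0 < r)
    (hΘ : m.Θ ⊆ Metric.closedBall 0 r) {z : Fin n → Vec d}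
    (hz : ∀ i, z i ∈ m.Z) {θs t R : Vec p} (hθs : θs ∈ m.Θ) (hstar : StarConvex ℝ θs m.Θ)
    (ht : t ∈ m.Θ) (hR : m.IsTaylorResidual z θs t R) :
    ENNReal.ofReal (‖R‖ ^ 2) ≤
      ENNReal.ofReal 16 * (ENNReal.ofReal (r ^ 4) * ∑ j, m.beta j ^ 2) := by
  have hdist : ‖t - θs‖ ≤ 2 * r := by
    have h1 := mem_closedBall_zero_iff.1 (hΘ ht)
    have h2 := mem_closedBall_zero_iff.1 (hΘ hθs)
    linarith [norm_sub_le t θs]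
  have hcoord : ∀ j, ENNReal.ofReal (R j ^ 2) ≤ ENNReal.ofReal (16 * r ^ 4) * m.beta j ^ 2 := by
    intro j
    -- If `β_j = ∞` the right side is `∞`, because `r > 0` keeps its coefficient away from `0`.
    by_cases hβ : m.beta j = ∞
    · rw [hβ, ENNReal.top_pow two_ne_zero,
        ENNReal.mul_top (ENNReal.ofReal_pos.2 (by positivity)).ne']
      exact le_top
    · have h := m.abs_taylorResidual_apply_le hn hz hθs hstar ht hR hβ
      have h' : |R j| ≤ (m.beta j).toReal * (2 * r) ^ 2 := h.trans (by gcongr)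
      have hsq : R j ^ 2 ≤ 16 * r ^ 4 * (m.beta j).toReal ^ 2 := by
        calc R j ^ 2 = |R j| ^ 2 := (sq_abs _).symm
          _ ≤ ((m.beta j).toReal * (2 * r) ^ 2) ^ 2 := by gcongr
          _ = _ := by ring
      refine (ENNReal.ofReal_le_ofReal hsq).trans_eq ?_
      rw [ENNReal.ofReal_mul (by positivity), ENNReal.ofReal_pow ENNReal.toReal_nonneg,
        ENNReal.ofReal_toReal hβ]
  rw [EuclideanSpace.real_norm_sq_eq, ENNReal.ofReal_sum_of_nonneg fun j _ => sq_nonneg _,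
    ← mul_assoc, ← ENNReal.ofReal_mul (by norm_num), Finset.mul_sum]
  exact Finset.sum_le_sum fun j _ => hcoord j

theorem ae_mem_Z (θ : Vec p) : ∀ᵐ x ∂m.law θ, x ∈ m.Z :=
  (withDensity_absolutelyContinuous _ _).ae_le (ae_restrict_mem m.measurableSet_Z)

end DensityFamily

theorem mainTheorem10 :
    ∃ C : ℝ, 0 < C ∧ ∀ r : ℝ, 0 < r → ∃ Cr : ℝ, 0 < Cr ∧
      ∀ (p n d : ℕ), 1 ≤ p → 1 ≤ n →
      ∀ (m : DensityFamily p d) (θs : Vec p) (δ τ : ℝ), 0 < δ → 0 < τ →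
        m.Θ ⊆ Metric.closedBall 0 r → θs ∈ m.Θ → StarConvex ℝ θs m.Θ →
        (∀ k, MemLp (fun z => m.score θs z k) 2 (m.law θs)) →
      ∀ (Ω : Type*) [MeasurableSpace Ω] (P : Measure Ω) [IsProbabilityMeasure P]
        (z : Fin n → Ω → Vec d) (θhat : Ω → Vec p),
        (∀ i, Measurable (z i)) → iIndepFun z P → (∀ i, P.map (z i) = m.law θs) →
        (∀ᵐ ω ∂P, m.IsPenalizedMLE (fun i => z i ω) τ (θhat ω)) →
      ∃ E : Set Ω, MeasurableSet E ∧ ENNReal.ofReal (1 - 2 / (p : ℝ)) ≤ P E ∧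
        ∀ ω ∈ E, ∀ R : Vec p, m.IsTaylorResidual (fun i => z i ω) θs (θhat ω) R →
          ENNReal.ofReal (‖R‖ ^ 2) ≤ ENNReal.ofReal C *
            max (ENNReal.ofReal (r ^ 6) * ∑ j, m.alpha δ j ^ 2)
              (ENNReal.ofReal (r ^ 4) * ∑ j, m.beta j ^ 2) ∧
          ENNReal.ofReal (weightedSq (m.fisher θs)
              (m.scaledResidual (fun i => z i ω) τ θs R)) ≤
            ENNReal.ofReal (C * (lambdaMax (m.fisher θs) / τ ^ 2)) *
              max (ENNReal.ofReal (r ^ 6) * ∑ j, m.alpha δ j ^ 2)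
                (ENNReal.ofReal (r ^ 4) * ∑ j, m.beta j ^ 2) ∧
          ENNReal.ofReal (weightedSq (m.fisher θs)
              (m.scaledResidual (fun i => z i ω) τ θs R)) ≤
            ENNReal.ofReal (Cr * (lambdaMax (m.fisher θs) / τ ^ 2)) *
              max (ENNReal.ofReal (r ^ 6) * ∑ j, m.beta j ^ 2)
                (ENNReal.ofReal (r ^ 4) * ∑ j, m.alpha δ j ^ 2) := by
  -- `16` is the coefficient in `(2r)⁴`; dividing by `r²` turns `r⁴` into `r⁶` for the third bound.
  refine ⟨16, by norm_num, fun r hr => ⟨16 / r ^ 2, by positivity, ?_⟩⟩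
  intro p n d hp hn m θs δ τ hδ hτ hΘ hθs hstar _ Ω _ P _ z θhat hzm _ hlaw hmle
  have hz : ∀ᵐ ω ∂P, ∀ i, z i ω ∈ m.Z := ae_all_iff.2 fun i =>
    ae_of_ae_map (hzm i).aemeasurable (by rw [hlaw i]; exact m.ae_mem_Z θs)
  -- `θhat` is not assumed measurable, so a measurable set of full probability is chosen inside the
  -- good event.
  obtain ⟨E, hE, hEm, hEω⟩ := (hz.and hmle).exists_measurable_mem
  refine ⟨E, hEm, ?_, fun ω hω R hR => ?_⟩
  · rw [prob_compl_eq_zero_iff hEm |>.1 hE, ENNReal.ofReal_le_one, sub_le_self_iff]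
    positivity
  obtain ⟨hzω, hmleω⟩ := hEω ω hω
  have hnorm := m.norm_sq_taylorResidual_le hn hr hΘ hzω hθs hstar hmleω.1 hR
  have hV := m.weightedSq_scaledResidual_le (fun i => z i ω) hτ θs R
  refine ⟨?_, ?_, ?_⟩
  · refine hnorm.trans ?_
    gcongr
    exact le_max_right _ _
  · refine hV.trans ?_
    rw [ENNReal.ofReal_mul (by norm_num), mul_comm (ENNReal.ofReal 16), mul_assoc]
    gcongr
    refine hnorm.trans ?_
    gcongr
    exact le_max_right _ _
  · refine hV.trans ?_
    rw [ENNReal.ofReal_mul (by positivity), mul_comm (ENNReal.ofReal (16 / r ^ 2)), mul_assoc]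
    gcongr
    refine hnorm.trans ?_
    have hr6 : ENNReal.ofReal 16 * ENNReal.ofReal (r ^ 4) =
        ENNReal.ofReal (16 / r ^ 2) * ENNReal.ofReal (r ^ 6) := by
      rw [← ENNReal.ofReal_mul (by norm_num), ← ENNReal.ofReal_mul (by positivity)]
      congr 1
      field_simp
    rw [← mul_assoc, hr6, mul_assoc]
    gcongr
    exact le_max_left _ _
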